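/- For a measurable function $u:\mathbb{R}^2\to\mathbb{R}$ in $\mathrm{L}^2(\mathbb{R}^2)$ let $$|\mathrm{D}u|(\mathbb{R}^2)=\sup\Big\{-\int_{\mathbb{R}^2}u\,\operatorname{div}z\,dx \;:\; z\in C_c^\infty(\mathbb{R}^2,\mathbb{R}^2),\ |z(x)|\le 1\ \text{for all }x\Big\}\in[0,+\infty]$$ be its total variation, let $$\tilde u(x)=\frac{1}{2\pi}\int_{\mathbb{S}^1}u(|x|\,e)\,d\mathcal{H}^1(e)$$ be its radialisation (the mean of $u$ over the circle of radius $|x|$ centered at the origin), and call $u$ radial if there is a function $g:[0,+\infty)\to\mathbb{R}$ such that $u(x)=g(|x|)$ for almost every $x\in\mathbb{R}^2$. Let $u\in\mathrm{L}^2(\mathbb{R}^2)$ be such that $|\mathrm{D}u|(\mathbb{R}^2)<+\infty$. Then $\tilde u$ is well defined (for almost every $x$, the function $e\mapsto u(|x|\,e)$ is $\mathcal{H}^1$-integrable on $\mathbb{S}^1$) and belongs to $\mathrm{L}^2(\mathbb{R}^2)$, and $$|\mathrm{D}\tilde u|(\mathbb{R}^2)\le|\mathrm{D}u|(\mathbb{R}^2).$$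 Equality holds if and only if $u$ is radial. -/

import Mathlib

open MeasureTheory Metric
open scoped ENNReal NNReal ContDiff

noncomputable section

/-- The Euclidean plane. -/
abbrev Plane : Type := EuclideanSpace ℝ (Fin 2)

/-- The divergence `∂₁ z₁ + ∂₂ z₂` of a (differentiable) vector field on the plane. -/
def divergence (z : Plane → Plane) (x : Plane) : ℝ :=
  ∑ i : Fin 2, (fderiv ℝ z x (EuclideanSpace.single i 1)) i

/-- The total variation `|Du|(ℝ²)`: the supremum of `-∫ u div z` over all smooth compactly
supported vector fields `z` with `‖z‖_∞ ≤ 1`. Since `z = 0` is admissible the supremum is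
nonnegative, so that truncating each of the integrals at zero does not change it. -/
def totalVariation (u : Plane → ℝ) : ℝ≥0∞ :=
  ⨆ (z : Plane → Plane) (_ : ContDiff ℝ ∞ z) (_ : HasCompactSupport z) (_ : ∀ x, ‖z x‖ ≤ 1),
    ENNReal.ofReal (-∫ x, u x * divergence z x)

/-- The radialisation of `u`: the mean over the unit circle, with respect to the one-dimensional
Hausdorff measure, of `e ↦ u (‖x‖ e)`. -/
def radialisation (u : Plane → ℝ) (x : Plane) : ℝ :=
  ⨍ e in sphere (0 : Plane) 1, u (‖x‖ • e) ∂μH[1]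

/-- `u` is radial: it agrees almost everywhere with a function of the norm. -/
def IsRadial (u : Plane → ℝ) : Prop :=
  ∃ g : ℝ≥0 → ℝ, ∀ᵐ x : Plane, u x = g ‖x‖₊

end

/-! Radialisation averages `u` over all rotations, so it is a symmetric operator on L²: testing the
radialised function against `div z` amounts to testing `u` against the radialised `div z`
(`integral_radialisation_mul`). The latter is again the divergence of an admissible field `w`,
obtained by averaging the conjugates of `z` under the reflection and then under all rotations.
Averaging preserves smoothness, compact support and the bound by one, and the inequality follows.
The reflection makes `w` orthogonal to the rotation field `quarterTurn x`
(`IsAdmissibleField.exists_radial`).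

Suppose equality holds. Then nearly optimal fields for `u` may be taken without tangential
component. By Pythagoras, adding `ε` times a tangential field to such a field costs only order `ε ^
2` after renormalisation, whereas a nonzero tangential derivative of `u` would yield a gain of order
`ε`. So the angular derivative of `u` vanishes in the weak sense
(`integral_tangential_derivative_eq_zero`). For a test function `b`, the difference `b -
radialisation b` is a weighted angular integral of angular derivatives
(`sub_radialisation_eq_integral`), so `u` is orthogonal to it; by symmetry `u - radialisation u` is
orthogonal to every `b`. Conversely, a radial function agrees a.e. with its radialisation. -/

section

open Set Real

/-! ### Rotations and the reflection of the plane -/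

/-- The rotation of the plane by the angle `θ`. -/
noncomputable def planeRotation (θ : ℝ) : Plane ≃ₗᵢ[ℝ] Plane where
  toFun x := !₂[cos θ * x 0 - sin θ * x 1, sin θ * x 0 + cos θ * x 1]
  invFun x := !₂[cos θ * x 0 + sin θ * x 1, -(sin θ * x 0) + cos θ * x 1]
  map_add' x y := by ext i; fin_cases i <;> simp <;> ring
  map_smul' c x := by ext i; fin_cases i <;> simp <;> ring
  left_inv x := by
    ext i
    fin_cases i <;> simp
    · linear_combination (x 0) * (cos_sq_add_sin_sq θ)
    · linear_combination (x 1) * (cos_sq_add_sin_sq θ)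
  right_inv x := by
    ext i
    fin_cases i <;> simp
    · linear_combination (x 0) * (cos_sq_add_sin_sq θ)
    · linear_combination (x 1) * (cos_sq_add_sin_sq θ)
  norm_map' x := by
    rw [← sq_eq_sq₀ (norm_nonneg _) (norm_nonneg _)]
    simp [EuclideanSpace.norm_sq_eq]
    linear_combination (x 0 ^ 2 + x 1 ^ 2) * (cos_sq_add_sin_sq θ)

@[simp] lemma planeRotation_apply_zero (θ : ℝ) (x : Plane) :
    planeRotation θ x 0 = cos θ * x 0 - sin θ * x 1 := rfl

@[simp] lemma planeRotation_apply_one (θ : ℝ) (x : Plane) :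
    planeRotation θ x 1 = sin θ * x 0 + cos θ * x 1 := rfl

/-- The reflection of the plane in the first coordinate axis. -/
noncomputable def planeReflection : Plane ≃ₗᵢ[ℝ] Plane where
  toFun x := !₂[x 0, -x 1]
  invFun x := !₂[x 0, -x 1]
  map_add' x y := by ext i; fin_cases i <;> simp; ring
  map_smul' c x := by ext i; fin_cases i <;> simp
  left_inv x := by ext i; fin_cases i <;> simp
  right_inv x := by ext i; fin_cases i <;> simp
  norm_map' x := by
    rw [← sq_eq_sq₀ (norm_nonneg _) (norm_nonneg _)]
    simp [EuclideanSpace.norm_sq_eq]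

@[simp] lemma planeReflection_apply_zero (x : Plane) : planeReflection x 0 = x 0 := rfl

@[simp] lemma planeReflection_apply_one (x : Plane) : planeReflection x 1 = -x 1 := rfl

@[simp] lemma planeReflection_planeReflection (x : Plane) :
    planeReflection (planeReflection x) = x := planeReflection.left_inv x

lemma planeReflection_symm : planeReflection.symm = planeReflection := rfl

/-- The rotation of the plane by a right angle, as a continuous linear map. -/
noncomputable def quarterTurn : Plane →L[ℝ] Plane := (planeRotation (π / 2)).toContinuousLinearEquiv

@[simp] lemma quarterTurn_apply_zero (x : Plane) : quarterTurn x 0 = -x 1 := by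
  change planeRotation (π / 2) x 0 = _
  simp

@[simp] lemma quarterTurn_apply_one (x : Plane) : quarterTurn x 1 = x 0 := by
  change planeRotation (π / 2) x 1 = _
  simp

lemma planeRotation_eq (θ : ℝ) (x : Plane) :
    planeRotation θ x = cos θ • x + sin θ • quarterTurn x := by
  ext i; fin_cases i <;> simp <;> ring

lemma planeRotation_planeRotation (θ φ : ℝ) (x : Plane) :
    planeRotation θ (planeRotation φ x) = planeRotation (θ + φ) x := by
  ext i; fin_cases i <;> simp [cos_add, sin_add] <;> ring

lemma planeRotation_symm (θ : ℝ) : (planeRotation θ).symm = planeRotation (-θ) := by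
  ext x i
  change (!₂[cos θ * x 0 + sin θ * x 1, -(sin θ * x 0) + cos θ * x 1] : Plane) i = _
  fin_cases i <;> simp

@[simp] lemma planeRotation_zero (x : Plane) : planeRotation 0 x = x := by
  ext i; fin_cases i <;> simp

lemma planeRotation_periodic (x : Plane) :
    Function.Periodic (fun θ ↦ planeRotation θ x) (2 * π) := by
  intro θ
  simp [planeRotation_eq]

lemma exists_planeRotation_eq {x y : Plane} (h : ‖x‖ = ‖y‖) : ∃ θ, planeRotation θ x = y := by
  rcases eq_or_ne x 0 with rfl | hx
  · exact ⟨0, by simpa using norm_eq_zero.1 (h.symm.trans norm_zero) |>.symm⟩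
  have hr : x 0 ^ 2 + x 1 ^ 2 ≠ 0 := by
    have : ‖x‖ ^ 2 ≠ 0 := by simpa using hx
    simpa [EuclideanSpace.norm_sq_eq] using this
  have h2 : x 0 ^ 2 + x 1 ^ 2 = y 0 ^ 2 + y 1 ^ 2 := by
    have := congrArg (· ^ 2) h
    simpa [EuclideanSpace.norm_sq_eq] using this
  -- In complex notation `c + i s` is the quotient `y / x`, of modulus one; its argument is the
  -- required angle.
  set c := (x 0 * y 0 + x 1 * y 1) / (x 0 ^ 2 + x 1 ^ 2) with hc
  set s := (x 0 * y 1 - x 1 * y 0) / (x 0 ^ 2 + x 1 ^ 2) with hs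
  have hcs : c ^ 2 + s ^ 2 = 1 := by
    rw [hc, hs]; field_simp
    linear_combination (-(x 0 ^ 2 + x 1 ^ 2)) * h2
  have hn : ‖(⟨c, s⟩ : ℂ)‖ = 1 := by
    rw [← sq_eq_sq₀ (norm_nonneg _) zero_le_one, Complex.sq_norm, Complex.normSq_mk]
    linear_combination hcs
  have h0 : (⟨c, s⟩ : ℂ) ≠ 0 := by rw [← norm_ne_zero_iff, hn]; exact one_ne_zero
  refine ⟨Complex.arg ⟨c, s⟩, ?_⟩
  ext i
  fin_cases i
  · simp only [Fin.zero_eta, planeRotation_apply_zero, Complex.cos_arg h0, Complex.sin_arg, hn]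
    rw [hc, hs]; field_simp; ring
  · simp only [Fin.mk_one, planeRotation_apply_one, Complex.cos_arg h0, Complex.sin_arg, hn]
    rw [hc, hs]; field_simp; ring

lemma contDiff_planeRotation : ContDiff ℝ ∞ (fun p : ℝ × Plane ↦ planeRotation p.1 p.2) := by
  simp only [planeRotation_eq]
  fun_prop

lemma continuous_planeRotation : Continuous (fun p : ℝ × Plane ↦ planeRotation p.1 p.2) :=
  contDiff_planeRotation.continuous

lemma continuous_planeRotation_left (x : Plane) : Continuous (fun θ ↦ planeRotation θ x) := by
  simp only [planeRotation_eq]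
  fun_prop

lemma inner_quarterTurn (x y : Plane) : inner ℝ x (quarterTurn y) = x 1 * y 0 - x 0 * y 1 := by
  simp [PiLp.inner_apply, Fin.sum_univ_two]; ring

/-! ### Uniform measures on angles and on the circle -/

/-- The uniform probability measure on the angles in `(0, 2π]`. -/
noncomputable def angleMeasure : Measure ℝ :=
  ENNReal.ofReal (2 * π)⁻¹ • volume.restrict (Ioc 0 (2 * π))

instance : IsProbabilityMeasure angleMeasure where
  measure_univ := by
    rw [angleMeasure, Measure.smul_apply, Measure.restrict_apply_univ, Real.volume_Ioc, smul_eq_mul,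
      ← ENNReal.ofReal_mul (by positivity), sub_zero, inv_mul_cancel₀ (by positivity),
      ENNReal.ofReal_one]

lemma integral_angleMeasure {E : Type*} [NormedAddCommGroup E] [NormedSpace ℝ E] (f : ℝ → E) :
    ∫ θ, f θ ∂angleMeasure = (2 * π)⁻¹ • ∫ θ in (0)..(2 * π), f θ := by
  rw [angleMeasure, integral_smul_measure, intervalIntegral.integral_of_le (by positivity),
    ENNReal.toReal_ofReal (by positivity)]

lemma integral_angleMeasure_comp_add {E : Type*} [NormedAddCommGroup E] [NormedSpace ℝ E]
    {f : ℝ → E} (hf : Function.Periodic f (2 * π)) (c : ℝ) :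
    ∫ θ, f (θ + c) ∂angleMeasure = ∫ θ, f θ ∂angleMeasure := by
  rw [integral_angleMeasure, integral_angleMeasure, intervalIntegral.integral_comp_add_right,
    zero_add, add_comm, hf.intervalIntegral_add_eq c 0, zero_add]

lemma integral_angleMeasure_comp_neg {E : Type*} [NormedAddCommGroup E] [NormedSpace ℝ E]
    {f : ℝ → E} (hf : Function.Periodic f (2 * π)) :
    ∫ θ, f (-θ) ∂angleMeasure = ∫ θ, f θ ∂angleMeasure := by
  have := hf.intervalIntegral_add_eq (-(2 * π)) 0
  rw [integral_angleMeasure, integral_angleMeasure, intervalIntegral.integral_comp_neg]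
  simp_all

/-- The uniform probability measure on the unit circle. -/
noncomputable def circleMeasure : Measure Plane :=
  (μH[1] (sphere (0 : Plane) 1))⁻¹ • (μH[1] : Measure Plane).restrict (sphere 0 1)

lemma planeRotation_image_Ioc {e : Plane} (he : e ∈ sphere (0 : Plane) 1) :
    (fun θ ↦ planeRotation θ e) '' Icc 0 (2 * π) = sphere 0 1 := by
  apply Subset.antisymm
  · rintro _ ⟨θ, -, rfl⟩
    simpa using he
  · intro y hy
    obtain ⟨θ, rfl⟩ := exists_planeRotation_eq (x := e) (y := y) (by simp_all)
    obtain ⟨t, ht, h⟩ := (planeRotation_periodic e).exists_mem_Ico₀ (by positivity) θ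
    exact ⟨t, Ico_subset_Icc_self ht, h.symm⟩

/-- The circle is the image of a bounded interval under a unit-speed, hence 1-Lipschitz, curve. -/
lemma hausdorffMeasure_circle_ne_top : μH[1] (sphere (0 : Plane) 1) ≠ ⊤ := by
  have he : (EuclideanSpace.single 0 1 : Plane) ∈ sphere (0 : Plane) 1 := by simp
  have hL : LipschitzOnWith (Real.toNNReal 1) (fun θ ↦ planeRotation θ (EuclideanSpace.single 0 1))
      (Icc 0 (2 * π)) := by
    refine (convex_Icc _ _).lipschitzOnWith_of_nnnorm_hasDerivWithin_le
      (f' := fun θ ↦ (-sin θ) • (EuclideanSpace.single 0 1 : Plane)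
        + cos θ • quarterTurn (EuclideanSpace.single 0 1)) (fun θ _ ↦ ?_) (fun θ _ ↦ ?_)
    · simp only [planeRotation_eq]
      exact (((hasDerivAt_cos θ).smul_const _).add
        ((hasDerivAt_sin θ).smul_const _)).hasDerivWithinAt
    · rw [← NNReal.coe_le_coe, coe_nnnorm]
      have : (-sin θ) • (EuclideanSpace.single 0 1 : Plane)
          + cos θ • quarterTurn (EuclideanSpace.single 0 1)
          = planeRotation (θ + π / 2) (EuclideanSpace.single 0 1) := by
        rw [planeRotation_eq, cos_add_pi_div_two, sin_add_pi_div_two]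
      rw [this]
      simp
  rw [← planeRotation_image_Ioc he]
  refine ne_top_of_le_ne_top ?_ (hL.hausdorffMeasure_image_le zero_le_one)
  rw [hausdorffMeasure_real, Real.volume_Icc]
  exact ENNReal.mul_ne_top (by simp) ENNReal.ofReal_ne_top

/-- The first coordinate is 1-Lipschitz and maps the circle onto a set containing `[-1, 1]`. With
finiteness, this makes the normalised `circleMeasure` a probability measure. -/
lemma hausdorffMeasure_circle_ne_zero : μH[1] (sphere (0 : Plane) 1) ≠ 0 := by
  have hL : LipschitzWith 1 (fun x : Plane ↦ x 0) :=
    LipschitzWith.of_dist_le_mul fun x y ↦ by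
      simpa [Real.dist_eq, EuclideanSpace.dist_eq] using
        Real.abs_le_sqrt (by nlinarith [sq_nonneg (x 1 - y 1), sq_abs (x 1 - y 1)])
  have hsub : Icc (-1 : ℝ) 1 ⊆ (fun x : Plane ↦ x 0) '' sphere (0 : Plane) 1 := by
    intro c hc
    refine ⟨!₂[c, √(1 - c ^ 2)], ?_, by simp⟩
    have : 0 ≤ 1 - c ^ 2 := by nlinarith [hc.1, hc.2]
    simp [EuclideanSpace.norm_eq, sq_sqrt this]
  have h := (measure_mono hsub).trans (hL.hausdorffMeasure_image_le zero_le_one (sphere 0 1))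
  rw [hausdorffMeasure_real, Real.volume_Icc] at h
  intro h0
  simp [h0] at h
  norm_num at h

instance : IsProbabilityMeasure circleMeasure where
  measure_univ := by
    rw [circleMeasure, Measure.smul_apply, Measure.restrict_apply_univ, smul_eq_mul,
      ENNReal.inv_mul_cancel hausdorffMeasure_circle_ne_zero hausdorffMeasure_circle_ne_top]

lemma radialisation_eq_integral_circleMeasure (u : Plane → ℝ) (x : Plane) :
    radialisation u x = ∫ e, u (‖x‖ • e) ∂circleMeasure := by
  simp only [radialisation, average, circleMeasure, Measure.restrict_apply_univ]

lemma integrableOn_circle_iff (f : Plane → ℝ) :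
    IntegrableOn f (sphere (0 : Plane) 1) μH[1] ↔ Integrable f circleMeasure := by
  rw [circleMeasure, IntegrableOn, integrable_smul_measure
    (by simpa using hausdorffMeasure_circle_ne_top)
    (by simpa using hausdorffMeasure_circle_ne_zero)]

lemma measurePreserving_circleMeasure (Q : Plane ≃ₗᵢ[ℝ] Plane) :
    MeasurePreserving Q circleMeasure circleMeasure := by
  have h := (Q.toIsometryEquiv.measurePreserving_hausdorffMeasure 1).restrict_preimage
    (s := sphere (0 : Plane) 1) isClosed_sphere.measurableSet
  have hs : Q.toIsometryEquiv ⁻¹' sphere (0 : Plane) 1 = sphere 0 1 := by ext; simp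
  rw [hs] at h
  exact h.smul_measure _

lemma ae_mem_circle : ∀ᵐ e ∂circleMeasure, e ∈ sphere (0 : Plane) 1 := by
  refine Measure.ae_smul_measure ?_ _
  exact ae_restrict_mem isClosed_sphere.measurableSet

/-- The image of the uniform measure on angles in the unit circle is the uniform measure. -/
lemma map_angleMeasure {e : Plane} (he : e ∈ sphere (0 : Plane) 1) :
    Measure.map (fun θ ↦ planeRotation θ e) angleMeasure = circleMeasure := by
  have hc : Continuous (fun θ ↦ planeRotation θ e) := continuous_planeRotation_left e
  have : IsProbabilityMeasure (Measure.map (fun θ ↦ planeRotation θ e) angleMeasure) :=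
    Measure.isProbabilityMeasure_map hc.aemeasurable
  -- The double integral of `f (planeRotation θ y)` is computed in both orders: the inner integral
  -- over `y` is constant by rotation invariance of the circle measure, the one over `θ` by
  -- transitivity of rotations and periodicity.
  refine ext_of_forall_integral_eq_of_IsFiniteMeasure fun f ↦ ?_
  rw [integral_map hc.aemeasurable f.continuous.aestronglyMeasurable]
  have h1 (θ : ℝ) : ∫ y, f (planeRotation θ y) ∂circleMeasure = ∫ y, f y ∂circleMeasure :=
    (measurePreserving_circleMeasure (planeRotation θ)).integral_comp
      (planeRotation θ).toHomeomorph.measurableEmbedding _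
  have h2 : ∀ᵐ y ∂circleMeasure, ∫ θ, f (planeRotation θ y) ∂angleMeasure
      = ∫ θ, f (planeRotation θ e) ∂angleMeasure := by
    filter_upwards [ae_mem_circle] with y hy
    obtain ⟨φ, rfl⟩ := exists_planeRotation_eq (x := e) (y := y) (by simp_all)
    simp only [planeRotation_planeRotation]
    exact integral_angleMeasure_comp_add (f := fun θ ↦ f (planeRotation θ e))
      ((planeRotation_periodic e).comp f) φ
  have h3 : Integrable (Function.uncurry fun (θ : ℝ) (y : Plane) ↦ f (planeRotation θ y))
      (angleMeasure.prod circleMeasure) :=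
    (f.compContinuous ⟨_, continuous_planeRotation⟩).integrable _
  have h4 := integral_integral_swap h3
  simp only [h1, integral_congr_ae h2] at h4
  simpa using h4.symm

lemma exists_mem_circle_eq_norm_smul (x : Plane) : ∃ e ∈ sphere (0 : Plane) 1, x = ‖x‖ • e := by
  rcases eq_or_ne x 0 with rfl | hx
  · exact ⟨EuclideanSpace.single 0 1, by simp, by simp⟩
  · exact ⟨‖x‖⁻¹ • x, by simp [norm_smul, hx], by rw [smul_inv_smul₀ (norm_ne_zero_iff.2 hx)]⟩

lemma radialisation_eq_integral_planeRotation {u : Plane → ℝ} {x : Plane}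
    (hu : AEStronglyMeasurable (fun e ↦ u (‖x‖ • e)) circleMeasure) :
    radialisation u x = ∫ θ, u (planeRotation θ x) ∂angleMeasure := by
  obtain ⟨e, he, hx⟩ := exists_mem_circle_eq_norm_smul x
  have hθ (θ : ℝ) : planeRotation θ x = ‖x‖ • planeRotation θ e := by
    rw [← map_smul, ← hx]
  rw [← map_angleMeasure he] at hu
  simp only [hθ]
  rw [radialisation_eq_integral_circleMeasure, ← map_angleMeasure he,
    integral_map (continuous_planeRotation_left e).aemeasurable hu]

lemma integrable_circle_iff {u : Plane → ℝ} {x : Plane}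
    (hu : AEStronglyMeasurable (fun e ↦ u (‖x‖ • e)) circleMeasure) :
    Integrable (fun e ↦ u (‖x‖ • e)) circleMeasure ↔
      Integrable (fun θ ↦ u (planeRotation θ x)) angleMeasure := by
  obtain ⟨e, he, hx⟩ := exists_mem_circle_eq_norm_smul x
  have hθ (θ : ℝ) : planeRotation θ x = ‖x‖ • planeRotation θ e := by
    rw [← map_smul, ← hx]
  rw [← map_angleMeasure he] at hu
  simp only [hθ]
  rw [← map_angleMeasure he,
    integrable_map_measure hu (continuous_planeRotation_left e).aemeasurable]
  rfl

lemma radialisation_congr_norm (u : Plane → ℝ) {x y : Plane} (h : ‖x‖ = ‖y‖) :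
    radialisation u x = radialisation u y := by
  simp only [radialisation, h]

lemma radialisation_comp_isometry (u : Plane → ℝ) (Q : Plane ≃ₗᵢ[ℝ] Plane) (x : Plane) :
    radialisation (fun y ↦ u (Q y)) x = radialisation u x := by
  rw [radialisation_eq_integral_circleMeasure, radialisation_eq_integral_circleMeasure]
  simp only [map_smul]
  exact (measurePreserving_circleMeasure Q).integral_comp
      Q.toHomeomorph.measurableEmbedding (fun e ↦ u (‖x‖ • e))

lemma radialisation_eq_of_continuous {u : Plane → ℝ} (hu : Continuous u) (x : Plane) :
    radialisation u x = ∫ θ, u (planeRotation θ x) ∂angleMeasure :=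
  radialisation_eq_integral_planeRotation
    (hu.comp (continuous_const_smul ‖x‖)).aestronglyMeasurable

/-! ### Almost every circle, and radialisation on L² -/

lemma measurePreserving_uncurry_swap {α β γ : Type*} [MeasurableSpace α] [MeasurableSpace β]
    [MeasurableSpace γ] {μ : Measure α} {ν : Measure β} {ρ : Measure γ} [IsProbabilityMeasure μ]
    [SFinite ν] [SFinite ρ] {g : α → β → γ} (hg : Measurable (Function.uncurry g))
    (h : ∀ a, Measure.map (g a) ν = ρ) :
    MeasurePreserving (fun p : β × α ↦ g p.2 p.1) (ν.prod μ) ρ := by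
  have h1 : MeasurePreserving (fun p : α × β ↦ (p.1, g p.1 p.2)) (μ.prod ν) (μ.prod ρ) :=
    MeasurePreserving.skew_product (MeasurePreserving.id _) hg (.of_forall h)
  have h2 : MeasurePreserving Prod.snd (μ.prod ρ) ρ := measurePreserving_snd
  exact (h2.comp h1).comp Measure.measurePreserving_swap

lemma measurePreserving_planeRotation {a : ℝ → ℝ} (ha : Continuous a) :
    MeasurePreserving (fun p : Plane × ℝ ↦ planeRotation (a p.2) p.1)
      ((volume : Measure Plane).prod angleMeasure) volume := by
  have hc : Continuous (fun p : ℝ × Plane ↦ (a p.1, p.2)) := by fun_prop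
  exact measurePreserving_uncurry_swap (g := fun θ (x : Plane) ↦ planeRotation (a θ) x)
    (continuous_planeRotation.comp hc).measurable
    fun θ ↦ (planeRotation (a θ)).measurePreserving.map_eq

lemma ae_ae_planeRotation {p : Plane → Prop} (hp : ∀ᵐ x, p x) :
    ∀ᵐ x : Plane, ∀ᵐ θ ∂angleMeasure, p (planeRotation θ x) :=
  Measure.ae_ae_of_ae_prod
    ((measurePreserving_planeRotation continuous_id).quasiMeasurePreserving.ae hp)

lemma ae_ae_circle {p : Plane → Prop} (hp : ∀ᵐ x, p x) :
    ∀ᵐ x : Plane, ∀ᵐ e ∂circleMeasure, p (‖x‖ • e) := by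
  -- The exceptional set is enlarged to a measurable null set, since transferring an a.e. statement
  -- through the pushforward from angles to the circle needs measurability.
  have hN : ∀ᵐ x : Plane, x ∉ toMeasurable volume {x | ¬ p x} := by
    rw [ae_iff] at hp ⊢
    simpa using hp
  filter_upwards [ae_ae_planeRotation hN] with x hx
  obtain ⟨e, he, hxe⟩ := exists_mem_circle_eq_norm_smul x
  have hθ (θ : ℝ) : planeRotation θ x = ‖x‖ • planeRotation θ e := by
    rw [← map_smul, ← hxe]
  simp only [hθ] at hx
  have hm : MeasurableSet {y : Plane | ‖x‖ • y ∉ toMeasurable volume {x | ¬ p x}} :=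
    ((measurableSet_toMeasurable _ _).preimage (measurable_const_smul ‖x‖)).compl
  have := (ae_map_iff (continuous_planeRotation_left e).aemeasurable hm).2 hx
  rw [map_angleMeasure he] at this
  filter_upwards [this] with y hy
  by_contra h
  exact hy (subset_toMeasurable _ _ h)

/-- Circles are null sets, so a.e. measurability in the plane passes only to almost every circle. -/
lemma ae_aestronglyMeasurable_circle {u : Plane → ℝ} (hu : AEStronglyMeasurable u volume) :
    ∀ᵐ x : Plane, AEStronglyMeasurable (fun e ↦ u (‖x‖ • e)) circleMeasure := by
  filter_upwards [ae_ae_circle hu.ae_eq_mk] with x hx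
  exact (hu.stronglyMeasurable_mk.comp_measurable
    (measurable_const_smul ‖x‖)).aestronglyMeasurable.congr (Filter.EventuallyEq.symm hx)

lemma radialisation_ae_eq {u : Plane → ℝ} (hu : AEStronglyMeasurable u volume) :
    radialisation u =ᵐ[volume] fun x ↦ ∫ θ, u (planeRotation θ x) ∂angleMeasure := by
  filter_upwards [ae_aestronglyMeasurable_circle hu] with x hx
  exact radialisation_eq_integral_planeRotation hx

lemma memLp_planeRotation {u : Plane → ℝ} (hu : MemLp u 2 volume) {a : ℝ → ℝ}
    (ha : Continuous a) :
    MemLp (fun p : Plane × ℝ ↦ u (planeRotation (a p.2) p.1)) 2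
      ((volume : Measure Plane).prod angleMeasure) :=
  hu.comp_measurePreserving (measurePreserving_planeRotation ha)

lemma ae_memLp_planeRotation {u : Plane → ℝ} (hu : MemLp u 2 volume) :
    ∀ᵐ x : Plane, MemLp (fun θ ↦ u (planeRotation θ x)) 2 angleMeasure := by
  have h := memLp_planeRotation hu continuous_id
  have h2 := (memLp_two_iff_integrable_sq h.1).1 h
  filter_upwards [h2.prod_right_ae, h.1.prodMk_left] with x hx hx'
  exact (memLp_two_iff_integrable_sq hx').2 hx

lemma ae_integrableOn_circle {u : Plane → ℝ} (hu : MemLp u 2 volume) :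
    ∀ᵐ x : Plane, IntegrableOn (fun e : Plane => u (‖x‖ • e)) (sphere (0 : Plane) 1) μH[1] := by
  filter_upwards [ae_memLp_planeRotation hu, ae_aestronglyMeasurable_circle hu.1] with x hx hx'
  rw [integrableOn_circle_iff, integrable_circle_iff hx']
  exact hx.integrable (by norm_num)

lemma sq_integral_le_integral_sq {Ω : Type*} [MeasurableSpace Ω] {μ : Measure Ω}
    [IsProbabilityMeasure μ] {f : Ω → ℝ} (hf : MemLp f 2 μ) :
    (∫ x, f x ∂μ) ^ 2 ≤ ∫ x, f x ^ 2 ∂μ := by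
  have h := ProbabilityTheory.variance_nonneg f μ
  rw [ProbabilityTheory.variance_eq_sub hf] at h
  simpa using h

/-- Jensen's inequality on each circle bounds the squared mean by the mean square, which is
integrable by Fubini and rotation invariance. -/
lemma memLp_radialisation {u : Plane → ℝ} (hu : MemLp u 2 volume) :
    MemLp (radialisation u) 2 volume := by
  have h := memLp_planeRotation hu continuous_id
  have h2 := (memLp_two_iff_integrable_sq h.1).1 h
  have hm : AEStronglyMeasurable (fun x : Plane ↦ ∫ θ, u (planeRotation θ x) ∂angleMeasure) :=
    h.1.integral_prod_right'
  refine MemLp.ae_eq (radialisation_ae_eq hu.1).symm ((memLp_two_iff_integrable_sq hm).2 ?_)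
  refine h2.integral_prod_left.mono' (hm.pow 2) ?_
  filter_upwards [ae_memLp_planeRotation hu] with x hx
  rw [norm_of_nonneg (sq_nonneg _)]
  exact sq_integral_le_integral_sq hx

/-- The radialisation is a symmetric operator on `L²`. -/
lemma integral_radialisation_mul {u φ : Plane → ℝ} (hu : MemLp u 2 volume)
    (hφ : MemLp φ 2 volume) :
    ∫ x, radialisation u x * φ x = ∫ x, u x * radialisation φ x := by
  have h1 : Integrable (fun p : Plane × ℝ ↦ u (planeRotation p.2 p.1) * φ p.1)
      ((volume : Measure Plane).prod angleMeasure) :=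
    (memLp_planeRotation hu continuous_id).integrable_mul (hφ.comp_fst _)
  have h2 : Integrable (fun p : Plane × ℝ ↦ u p.1 * φ (planeRotation (-p.2) p.1))
      ((volume : Measure Plane).prod angleMeasure) :=
    (hu.comp_fst _).integrable_mul (memLp_planeRotation hφ continuous_neg)
  calc ∫ x, radialisation u x * φ x
      = ∫ x : Plane, ∫ θ, u (planeRotation θ x) * φ x ∂angleMeasure := by
        refine integral_congr_ae ?_
        filter_upwards [radialisation_ae_eq hu.1] with x hx
        rw [hx, integral_mul_const]
    _ = ∫ θ, (∫ x : Plane, u (planeRotation θ x) * φ x) ∂angleMeasure := integral_integral_swap h1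
    _ = ∫ θ, (∫ x : Plane, u x * φ (planeRotation (-θ) x)) ∂angleMeasure := by
        congr 1 with θ
        rw [← (planeRotation (-θ)).measurePreserving.integral_comp
          (planeRotation (-θ)).toHomeomorph.measurableEmbedding]
        simp [planeRotation_planeRotation]
    _ = ∫ x : Plane, ∫ θ, u x * φ (planeRotation (-θ) x) ∂angleMeasure :=
        (integral_integral_swap h2).symm
    _ = ∫ x, u x * radialisation φ x := by
        refine integral_congr_ae ?_
        filter_upwards [radialisation_ae_eq hφ.1] with x hx
        rw [hx, integral_const_mul]
        congr 1
        exact integral_angleMeasure_comp_neg (f := fun θ ↦ φ (planeRotation θ x))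
          fun θ ↦ congrArg φ (planeRotation_periodic x θ)

/-- A function that is a.e. radial agrees a.e. with its radialisation. -/
lemma IsRadial.radialisation_ae_eq {u : Plane → ℝ} (hu : IsRadial u) :
    radialisation u =ᵐ[volume] u := by
  obtain ⟨g, hg⟩ := hu
  filter_upwards [hg, ae_ae_circle hg] with x hx hx'
  rw [radialisation_eq_integral_circleMeasure, hx]
  have : (fun e ↦ u (‖x‖ • e)) =ᵐ[circleMeasure] fun _ ↦ g ‖x‖₊ := by
    filter_upwards [hx', ae_mem_circle] with e he he'
    rw [he]
    congr 1
    ext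
    have : ‖e‖ = 1 := by simpa using he'
    simp [norm_smul, this]
  rw [integral_congr_ae this]
  simp

lemma isRadial_of_ae_eq_radialisation {u : Plane → ℝ} (h : u =ᵐ[volume] radialisation u) :
    IsRadial u := by
  -- The radialisation depends only on the norm, so its values along one ray give the profile.
  refine ⟨fun r ↦ radialisation u ((r : ℝ) • EuclideanSpace.single 0 1), ?_⟩
  filter_upwards [h] with x hx
  rw [hx]
  exact radialisation_congr_norm u (by simp [norm_smul])

/-! ### Calculus of the divergence -/

lemma totalVariation_congr {u v : Plane → ℝ} (h : u =ᵐ[volume] v) :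
    totalVariation u = totalVariation v := by
  unfold totalVariation
  have (z : Plane → Plane) : ∫ x, u x * divergence z x = ∫ x, v x * divergence z x := by
    refine integral_congr_ae ?_
    filter_upwards [h] with x hx
    rw [hx]
  simp only [this]

/-- The trace of a continuous endomorphism of the plane, as a continuous linear functional. -/
noncomputable def planeTrace : (Plane →L[ℝ] Plane) →L[ℝ] ℝ :=
  ∑ i : Fin 2, (EuclideanSpace.proj i : Plane →L[ℝ] ℝ) ∘L
    ContinuousLinearMap.apply ℝ Plane (EuclideanSpace.single i 1 : Plane)

lemma divergence_eq_planeTrace (z : Plane → Plane) (x : Plane) :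
    divergence z x = planeTrace (fderiv ℝ z x) := by
  simp [divergence, planeTrace]

lemma planeTrace_eq_trace (L : Plane →L[ℝ] Plane) :
    planeTrace L = LinearMap.trace ℝ Plane L.toLinearMap := by
  rw [LinearMap.trace_eq_sum_inner _ (EuclideanSpace.basisFun (Fin 2) ℝ)]
  simp [planeTrace, Fin.sum_univ_two, EuclideanSpace.inner_single_left]

lemma planeTrace_conj (Q : Plane ≃ₗᵢ[ℝ] Plane) (L : Plane →L[ℝ] Plane) :
    planeTrace ((Q.toContinuousLinearEquiv : Plane →L[ℝ] Plane) ∘L L ∘L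
      (Q.symm.toContinuousLinearEquiv : Plane →L[ℝ] Plane)) = planeTrace L := by
  rw [planeTrace_eq_trace, planeTrace_eq_trace,
    ← LinearMap.trace_conj' L.toLinearMap Q.toLinearEquiv]
  rfl

/-- The derivative of the conjugated field is the conjugated derivative, and the trace is invariant
under conjugation. -/
lemma divergence_conj (Q : Plane ≃ₗᵢ[ℝ] Plane) {z : Plane → Plane} (hz : Differentiable ℝ z)
    (x : Plane) : divergence (fun y ↦ Q (z (Q.symm y))) x = divergence z (Q.symm x) := by
  rw [divergence_eq_planeTrace, divergence_eq_planeTrace,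
    ← planeTrace_conj Q (fderiv ℝ z (Q.symm x))]
  congr 1
  exact ((Q.toContinuousLinearEquiv.hasFDerivAt).comp x
    ((hz (Q.symm x)).hasFDerivAt.comp x Q.symm.toContinuousLinearEquiv.hasFDerivAt)).fderiv

lemma divergence_add_smul {z w : Plane → Plane} (hz : Differentiable ℝ z)
    (hw : Differentiable ℝ w) (a b : ℝ) (x : Plane) :
    divergence (fun y ↦ a • z y + b • w y) x = a * divergence z x + b * divergence w x := by
  simp only [divergence_eq_planeTrace]
  have h : HasFDerivAt (fun y ↦ a • z y + b • w y) _ x :=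
    ((hz x).hasFDerivAt.const_smul a).add ((hw x).hasFDerivAt.const_smul b)
  rw [h.fderiv]
  simp

/-- The field `quarterTurn` is divergence free, so only the derivative of `b` along it, the angular
derivative, survives. -/
lemma divergence_smul_quarterTurn {b : Plane → ℝ} (hb : Differentiable ℝ b) (x : Plane) :
    divergence (fun y ↦ b y • quarterTurn y) x = fderiv ℝ b x (quarterTurn x) := by
  have h : HasFDerivAt (fun y ↦ b y • quarterTurn y) _ x :=
    (hb x).hasFDerivAt.smul quarterTurn.hasFDerivAt
  rw [divergence, h.fderiv]
  have hx : quarterTurn x = (-x 1) • (EuclideanSpace.single 0 1 : Plane)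
      + x 0 • EuclideanSpace.single 1 1 := by
    ext i; fin_cases i <;> simp
  conv_rhs => rw [hx, map_add, map_smul, map_smul]
  simp [Fin.sum_univ_two]
  ring

lemma continuous_divergence {z : Plane → Plane} (hz : ContDiff ℝ ∞ z) :
    Continuous (divergence z) := by
  have : divergence z = fun x ↦ planeTrace (fderiv ℝ z x) :=
    funext (divergence_eq_planeTrace z)
  rw [this]
  exact planeTrace.continuous.comp (hz.continuous_fderiv (by simp))

lemma hasCompactSupport_divergence {z : Plane → Plane} (hz : HasCompactSupport z) :
    HasCompactSupport (divergence z) := by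
  have : divergence z = fun x ↦ planeTrace (fderiv ℝ z x) :=
    funext (divergence_eq_planeTrace z)
  rw [this]
  exact (hz.fderiv ℝ).comp_left (g := planeTrace) (map_zero _)

lemma memLp_divergence {z : Plane → Plane} (hz : ContDiff ℝ ∞ z) (hc : HasCompactSupport z) :
    MemLp (divergence z) 2 volume :=
  (continuous_divergence hz).memLp_of_hasCompactSupport (hasCompactSupport_divergence hc)

/-! ### Differentiation under the angular average -/

/-- Averages over the angle of smooth families of maps are smooth. -/
lemma contDiff_integral_angleMeasure {F : Plane → ℝ → Plane}
    (hF : ContDiff ℝ ∞ (Function.uncurry F)) :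
    ContDiff ℝ ∞ (fun y ↦ ∫ θ, F y θ ∂angleMeasure) := by
  -- The average is written as the convolution at `0` of the normalised indicator `f` with `s ↦ χ s
  -- • F y (-s)`. The cutoff supplies compact support in `s`; it equals one up to radius `7 > 2 *
  -- π`, so it does not alter the integral.
  let χ : ContDiffBump (0 : ℝ) := ⟨7, 8, by norm_num, by norm_num⟩
  let f : ℝ → ℝ := (Ioc 0 (2 * π)).indicator fun _ ↦ (2 * π)⁻¹
  have hf : LocallyIntegrable f volume := by
    refine (IntegrableOn.integrable_indicator ?_ measurableSet_Ioc).locallyIntegrable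
    exact integrableOn_const (by simp [ENNReal.mul_eq_top])
  have hg : ContDiff ℝ ∞ (Function.uncurry fun (y : Plane) (s : ℝ) ↦ χ s • F y (-s)) := by
    have h1 : ContDiff ℝ ∞ (fun p : Plane × ℝ ↦ χ p.2) := χ.contDiff.comp contDiff_snd
    have h2 : ContDiff ℝ ∞ (fun p : Plane × ℝ ↦ F p.1 (-p.2)) :=
      hF.comp (contDiff_fst.prodMk contDiff_snd.neg)
    exact h1.smul h2
  have h := contDiffOn_convolution_right_with_param_comp (n := ⊤) (μ := volume)
    (ContinuousLinearMap.lsmul ℝ ℝ : ℝ →L[ℝ] Plane →L[ℝ] Plane) (s := (univ : Set Plane))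
    (v := fun _ ↦ (0 : ℝ)) contDiffOn_const (f := f) (g := fun y s ↦ χ s • F y (-s))
    isOpen_univ (isCompact_closedBall (0 : ℝ) 8) (fun p x _ hx ↦ ?_) hf hg.contDiffOn
  · rw [contDiffOn_univ] at h
    convert h using 2 with y
    rw [integral_angleMeasure, intervalIntegral.integral_of_le (by positivity),
      ← integral_smul, ← integral_indicator measurableSet_Ioc, convolution]
    congr 1 with θ : 1
    by_cases hθ : θ ∈ Ioc 0 (2 * π)
    · have hχ : χ (0 - θ) = 1 := χ.one_of_mem_closedBall <| by
        have := pi_lt_d2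
        simp only [mem_closedBall, dist_zero_right, zero_sub, norm_neg, norm_eq_abs,
          abs_of_pos hθ.1]
        change θ ≤ 7
        linarith [hθ.2]
      rw [indicator_of_mem hθ, hχ]
      simp [f, indicator_of_mem hθ]
    · rw [indicator_of_notMem hθ]
      simp [f, indicator_of_notMem hθ]
  · have : χ x = 0 := χ.zero_of_le_dist <| by
      simpa using (not_le.1 (by simpa using hx : ¬ |x| ≤ 8)).le
    simp [this]

lemma ae_angleMeasure_mem : ∀ᵐ θ ∂angleMeasure, θ ∈ Ioc 0 (2 * π) :=
  Measure.ae_smul_measure (ae_restrict_mem measurableSet_Ioc) _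

lemma integrable_angleMeasure_of_continuous {E : Type*} [NormedAddCommGroup E] {f : ℝ → E}
    (hf : Continuous f) : Integrable f angleMeasure :=
  ((hf.integrableOn_Icc (a := 0) (b := 2 * π)).mono_set Ioc_subset_Icc_self).smul_measure
    ENNReal.ofReal_ne_top

lemma hasFDerivAt_left_of_uncurry {F : Plane → ℝ → Plane}
    (hF : ContDiff ℝ ∞ (Function.uncurry F)) (y : Plane) (θ : ℝ) :
    HasFDerivAt (fun y ↦ F y θ)
      (fderiv ℝ (Function.uncurry F) (y, θ) ∘L ContinuousLinearMap.inl ℝ Plane ℝ) y := by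
  have h : HasFDerivAt (Function.uncurry F) (fderiv ℝ (Function.uncurry F) (y, θ)) (y, θ) :=
    (hF.differentiable (by simp) (y, θ)).hasFDerivAt
  exact HasFDerivAt.comp (f := fun y : Plane ↦ (y, θ)) y h (hasFDerivAt_prodMk_left y θ)

lemma hasFDerivAt_integral_angleMeasure {F : Plane → ℝ → Plane}
    (hF : ContDiff ℝ ∞ (Function.uncurry F)) (x : Plane) :
    HasFDerivAt (fun y ↦ ∫ θ, F y θ ∂angleMeasure)
      (∫ θ, fderiv ℝ (fun y ↦ F y θ) x ∂angleMeasure) x := by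
  have hcont : Continuous fun p : Plane × ℝ ↦
      fderiv ℝ (Function.uncurry F) p ∘L ContinuousLinearMap.inl ℝ Plane ℝ :=
    (hF.continuous_fderiv (by simp)).clm_comp continuous_const
  have hF1 (y : Plane) : Continuous (F y) :=
    hF.continuous.comp (by fun_prop : Continuous fun θ : ℝ ↦ (y, θ))
  obtain ⟨C, hC⟩ := ((isCompact_closedBall x 1).prod
    (isCompact_Icc (a := 0) (b := 2 * π))).exists_bound_of_continuousOn
    hcont.continuousOn
  simp only [fun θ ↦ (hasFDerivAt_left_of_uncurry hF x θ).fderiv]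
  refine hasFDerivAt_integral_of_dominated_of_fderiv_le (s := ball x 1) (bound := fun _ ↦ C)
    (F' := fun y θ ↦ fderiv ℝ (Function.uncurry F) (y, θ) ∘L ContinuousLinearMap.inl ℝ Plane ℝ)
    (ball_mem_nhds x one_pos) (.of_forall fun y ↦ (hF1 y).aestronglyMeasurable)
    (integrable_angleMeasure_of_continuous (hF1 x))
    (hcont.comp (by fun_prop : Continuous fun θ : ℝ ↦ (x, θ))).aestronglyMeasurable
    ?_ (integrable_const C) (.of_forall fun θ y _ ↦ hasFDerivAt_left_of_uncurry hF y θ)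
  filter_upwards [ae_angleMeasure_mem] with θ hθ y hy
  exact hC (y, θ) ⟨ball_subset_closedBall hy, Ioc_subset_Icc_self hθ⟩

lemma divergence_integral_angleMeasure {F : Plane → ℝ → Plane}
    (hF : ContDiff ℝ ∞ (Function.uncurry F)) (x : Plane) :
    divergence (fun y ↦ ∫ θ, F y θ ∂angleMeasure) x
      = ∫ θ, divergence (fun y ↦ F y θ) x ∂angleMeasure := by
  simp only [divergence_eq_planeTrace]
  rw [(hasFDerivAt_integral_angleMeasure hF x).fderiv]
  refine (planeTrace.integral_comp_comm (integrable_angleMeasure_of_continuous ?_)).symm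
  simp only [fun θ ↦ (hasFDerivAt_left_of_uncurry hF x θ).fderiv]
  exact ((hF.continuous_fderiv (by simp)).comp
    (by fun_prop : Continuous fun θ : ℝ ↦ (x, θ))).clm_comp continuous_const

/-! ### Admissible fields and their symmetrisation -/

/-- The smooth compactly supported vector fields of norm at most one. -/
structure IsAdmissibleField (z : Plane → Plane) : Prop where
  contDiff : ContDiff ℝ ∞ z
  hasCompactSupport : HasCompactSupport z
  norm_le_one : ∀ x, ‖z x‖ ≤ 1

lemma IsAdmissibleField.le_totalVariation {z : Plane → Plane} (hz : IsAdmissibleField z)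
    (u : Plane → ℝ) : ENNReal.ofReal (-∫ x, u x * divergence z x) ≤ totalVariation u :=
  le_iSup₂_of_le z hz.1 (le_iSup₂_of_le hz.2 hz.3 le_rfl)

lemma IsAdmissibleField.le_toReal_totalVariation {z : Plane → Plane} (hz : IsAdmissibleField z)
    {u : Plane → ℝ} (hu : totalVariation u < ⊤) :
    -∫ x, u x * divergence z x ≤ (totalVariation u).toReal :=
  (ENNReal.ofReal_le_iff_le_toReal hu.ne).1 (hz.le_totalVariation u)

lemma totalVariation_le {u : Plane → ℝ} {T : ℝ≥0∞}
    (h : ∀ z, IsAdmissibleField z → ENNReal.ofReal (-∫ x, u x * divergence z x) ≤ T) :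
    totalVariation u ≤ T :=
  iSup₂_le fun z h1 ↦ iSup₂_le fun h2 h3 ↦ h z ⟨h1, h2, h3⟩

lemma isAdmissibleField_zero : IsAdmissibleField 0 :=
  ⟨contDiff_const, HasCompactSupport.zero, by simp⟩

lemma planeRotation_quarterTurn (θ : ℝ) (x : Plane) :
    planeRotation θ (quarterTurn x) = quarterTurn (planeRotation θ x) := by
  ext i; fin_cases i <;> simp <;> ring

lemma contDiff_planeRotation_comp {E : Type*} [NormedAddCommGroup E] [NormedSpace ℝ E] {f : E → ℝ}
    {g : E → Plane} (hf : ContDiff ℝ ∞ f) (hg : ContDiff ℝ ∞ g) :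
    ContDiff ℝ ∞ (fun x ↦ planeRotation (f x) (g x)) := by
  simp only [planeRotation_eq]
  fun_prop

/-- Symmetrisation of an admissible field with respect to the reflection. -/
lemma IsAdmissibleField.exists_reflection_invariant {z : Plane → Plane}
    (hz : IsAdmissibleField z) :
    ∃ v, IsAdmissibleField v ∧ (∀ x, v (planeReflection x) = planeReflection (v x)) ∧
      ∀ x, divergence v x
        = 1 / 2 * divergence z x + 1 / 2 * divergence z (planeReflection x) := by
  have hzd : Differentiable ℝ z := hz.1.differentiable (by simp)
  have hSz : ContDiff ℝ ∞ (fun y ↦ planeReflection (z (planeReflection.symm y))) :=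
    planeReflection.contDiff.comp (hz.1.comp planeReflection.symm.contDiff)
  have hSs : HasCompactSupport (fun y ↦ planeReflection (z (planeReflection.symm y))) :=
    (hz.2.comp_homeomorph planeReflection.symm.toHomeomorph).comp_left (map_zero planeReflection)
  refine ⟨fun y ↦ (1 / 2 : ℝ) • z y + (1 / 2 : ℝ) • planeReflection (z (planeReflection.symm y)),
    ⟨(hz.1.const_smul _).add (hSz.const_smul _),
      (hz.2.smul_left (f := fun _ ↦ (1 / 2 : ℝ))).add
        (hSs.smul_left (f := fun _ ↦ (1 / 2 : ℝ))), fun x ↦ ?_⟩, fun x ↦ ?_, fun x ↦ ?_⟩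
  · have h1 := hz.norm_le_one x
    have h2 := hz.norm_le_one (planeReflection.symm x)
    refine (norm_add_le _ _).trans ?_
    rw [norm_smul, norm_smul, LinearIsometryEquiv.norm_map]
    norm_num
    linarith
  · simp [planeReflection_symm, add_comm]
  · rw [divergence_add_smul hzd (hSz.differentiable (by simp)), divergence_conj _ hzd]
    rfl

/-- The average over all rotations of the conjugates of a vector field. -/
noncomputable def rotationAverage (v : Plane → Plane) (y : Plane) : Plane :=
  ∫ θ, planeRotation θ (v (planeRotation (-θ) y)) ∂angleMeasure

lemma contDiff_rotation_conj {v : Plane → Plane} (hv : ContDiff ℝ ∞ v) :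
    ContDiff ℝ ∞ (Function.uncurry fun (y : Plane) (θ : ℝ) ↦
      planeRotation θ (v (planeRotation (-θ) y))) :=
  contDiff_planeRotation_comp contDiff_snd
    (hv.comp (contDiff_planeRotation_comp contDiff_snd.neg contDiff_fst))

lemma continuous_rotation_conj {v : Plane → Plane} (hv : ContDiff ℝ ∞ v) (y : Plane) :
    Continuous fun θ : ℝ ↦ planeRotation θ (v (planeRotation (-θ) y)) :=
  (contDiff_planeRotation_comp contDiff_id (hv.comp
    (contDiff_planeRotation_comp contDiff_neg contDiff_const))).continuous

lemma IsAdmissibleField.rotationAverage {v : Plane → Plane} (hv : IsAdmissibleField v) :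
    IsAdmissibleField (rotationAverage v) := by
  refine ⟨contDiff_integral_angleMeasure (contDiff_rotation_conj hv.1), ?_, fun x ↦ ?_⟩
  · obtain ⟨R, hR⟩ := hv.hasCompactSupport.isCompact.isBounded.subset_closedBall 0
    refine HasCompactSupport.intro (isCompact_closedBall (0 : Plane) R) fun x hx ↦ ?_
    have (θ : ℝ) : v (planeRotation (-θ) x) = 0 := by
      refine image_eq_zero_of_notMem_tsupport fun h ↦ hx ?_
      simpa using hR h
    simp [_root_.rotationAverage, this]
  · refine (norm_integral_le_of_norm_le_const (C := 1) (.of_forall fun θ ↦ ?_)).trans (by simp)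
    rw [LinearIsometryEquiv.norm_map]
    exact hv.norm_le_one _

lemma divergence_rotationAverage {v : Plane → Plane} (hv : ContDiff ℝ ∞ v) (x : Plane) :
    divergence (rotationAverage v) x = radialisation (divergence v) x := by
  have h := divergence_integral_angleMeasure (contDiff_rotation_conj hv) x
  have hd (θ : ℝ) := divergence_conj (planeRotation θ) (hv.differentiable (by simp)) x
  simp only [planeRotation_symm] at hd
  simp only [hd] at h
  rw [integral_angleMeasure_comp_neg (f := fun θ ↦ divergence v (planeRotation θ x))
    fun θ ↦ congrArg _ (planeRotation_periodic x θ),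
    ← radialisation_eq_of_continuous (continuous_divergence hv)] at h
  exact h

/-- Rotations are isometries commuting with `quarterTurn`, so the tangential component can be
averaged directly as a scalar function. -/
lemma inner_rotationAverage_quarterTurn {v : Plane → Plane} (hv : ContDiff ℝ ∞ v) (x : Plane) :
    inner ℝ (rotationAverage v x) (quarterTurn x)
      = radialisation (fun y ↦ inner ℝ (v y) (quarterTurn y)) x := by
  have hc : Continuous fun y ↦ inner ℝ (v y) (quarterTurn y) :=
    hv.continuous.inner quarterTurn.continuous
  rw [radialisation_eq_of_continuous hc, ← integral_angleMeasure_comp_neg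
      (f := fun θ ↦ inner ℝ (v (planeRotation θ x)) (quarterTurn (planeRotation θ x)))
      fun θ ↦ congrArg (fun y ↦ inner ℝ (v y) (quarterTurn y)) (planeRotation_periodic x θ),
    real_inner_comm, rotationAverage,
    ← integral_inner (integrable_angleMeasure_of_continuous (continuous_rotation_conj hv x))]
  congr 1 with θ
  rw [real_inner_comm, ← (planeRotation θ).inner_map_map (v _), planeRotation_quarterTurn,
    planeRotation_planeRotation, add_neg_cancel, planeRotation_zero]

/-- The reflection preserves the circle measure, so the mean equals its own negative. -/
lemma radialisation_eq_zero_of_odd {h : Plane → ℝ} (hodd : ∀ y, h (planeReflection y) = -h y)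
    (x : Plane) : radialisation h x = 0 := by
  have h1 := radialisation_comp_isometry h planeReflection x
  simp only [hodd] at h1
  have h2 : radialisation (fun y ↦ -h y) x = -radialisation h x := by
    simp only [radialisation_eq_integral_circleMeasure, integral_neg]
  linarith

/-- The radialisation of the divergence of an admissible field is the divergence of an admissible
field without tangential component. -/
lemma IsAdmissibleField.exists_radial {z : Plane → Plane} (hz : IsAdmissibleField z) :
    ∃ w, IsAdmissibleField w ∧ (∀ x, inner ℝ (w x) (quarterTurn x) = 0) ∧
      ∀ x, divergence w x = radialisation (divergence z) x := by
  obtain ⟨v, hv, hvS, hvdiv⟩ := hz.exists_reflection_invariant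
  refine ⟨_root_.rotationAverage v, hv.rotationAverage, fun x ↦ ?_, fun x ↦ ?_⟩
  · rw [inner_rotationAverage_quarterTurn hv.1]
    -- The reflection reverses orientation: it anticommutes with `quarterTurn`, so the tangential
    -- component of the equivariant field `v` is odd.
    refine radialisation_eq_zero_of_odd (fun y ↦ ?_) x
    simp only [hvS, inner_quarterTurn, planeReflection_apply_zero, planeReflection_apply_one]
    ring
  · have hzc := continuous_divergence hz.1
    have hzS : Continuous fun y ↦ divergence z (planeReflection y) :=
      hzc.comp planeReflection.continuous
    have h1 := radialisation_comp_isometry (divergence z) planeReflection x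
    rw [radialisation_eq_of_continuous hzS, radialisation_eq_of_continuous hzc] at h1
    rw [divergence_rotationAverage hv.1, radialisation_eq_of_continuous hzc,
      radialisation_eq_of_continuous (continuous_divergence hv.1)]
    have hr := continuous_planeRotation_left x
    simp only [hvdiv]
    have hi : Integrable (fun θ ↦ divergence z (planeRotation θ x)) angleMeasure :=
      integrable_angleMeasure_of_continuous (hzc.comp hr)
    have hiS : Integrable (fun θ ↦ divergence z (planeReflection (planeRotation θ x)))
        angleMeasure := integrable_angleMeasure_of_continuous (hzS.comp hr)
    rw [integral_add (hi.const_mul _) (hiS.const_mul _), integral_const_mul,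
      integral_const_mul, h1]
    ring

lemma IsAdmissibleField.exists_radial_integral_eq {z : Plane → Plane} (hz : IsAdmissibleField z)
    {u : Plane → ℝ} (hu : MemLp u 2 volume) :
    ∃ w, IsAdmissibleField w ∧ (∀ x, inner ℝ (w x) (quarterTurn x) = 0) ∧
      ∫ x, radialisation u x * divergence z x = ∫ x, u x * divergence w x := by
  obtain ⟨w, hw, hwt, hwd⟩ := hz.exists_radial
  refine ⟨w, hw, hwt, ?_⟩
  rw [integral_radialisation_mul hu (memLp_divergence hz.1 hz.2)]
  simp only [hwd]

/-! ### The inequality, and the variational argument under equality -/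

lemma totalVariation_radialisation_le {u : Plane → ℝ} (hu : MemLp u 2 volume) :
    totalVariation (radialisation u) ≤ totalVariation u := by
  refine totalVariation_le fun z hz ↦ ?_
  obtain ⟨w, hw, -, h⟩ := hz.exists_radial_integral_eq hu
  rw [h]
  exact hw.le_totalVariation u

/-- If every admissible field without tangential part stayed `δ` below the total variation of `u`,
duality would force the radialised function to lose at least `δ` as well. -/
lemma exists_radial_lt_integral {u : Plane → ℝ} (hu : MemLp u 2 volume)
    (h : totalVariation (radialisation u) = totalVariation u)
    {δ : ℝ} (hδ : 0 < δ) :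
    ∃ w, IsAdmissibleField w ∧ (∀ x, inner ℝ (w x) (quarterTurn x) = 0) ∧
      (totalVariation u).toReal - δ < -∫ x, u x * divergence w x := by
  by_contra! hcon
  have hz (z : Plane → Plane) (hz : IsAdmissibleField z) :
      -∫ x, radialisation u x * divergence z x ≤ (totalVariation u).toReal - δ := by
    obtain ⟨w, hw, hwt, hwi⟩ := hz.exists_radial_integral_eq hu
    rw [hwi]
    exact hcon w hw hwt
  -- The zero field shows that the truncation in `ENNReal.ofReal` is harmless here.
  have h0 : 0 ≤ (totalVariation u).toReal - δ := by
    simpa [divergence] using hz 0 isAdmissibleField_zero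
  have h1 : totalVariation u ≤ ENNReal.ofReal ((totalVariation u).toReal - δ) := by
    rw [← h]
    exact totalVariation_le fun z hz' ↦ ENNReal.ofReal_le_ofReal (h ▸ hz z hz')
  have h2 := ENNReal.toReal_mono ENNReal.ofReal_ne_top h1
  rw [ENNReal.toReal_ofReal h0] at h2
  linarith

/-- If radialising does not decrease the total variation then the tangential derivative has no
positive part. -/
lemma integral_divergence_tangential_nonneg {u : Plane → ℝ} (hu : MemLp u 2 volume)
    (hT : totalVariation u < ⊤) (h : totalVariation (radialisation u) = totalVariation u)
    {b : Plane → ℝ} (hb : IsAdmissibleField fun x ↦ b x • quarterTurn x) :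
    0 ≤ ∫ x, u x * divergence (fun x ↦ b x • quarterTurn x) x := by
  by_contra! hneg
  set c := -∫ x, u x * divergence (fun x ↦ b x • quarterTurn x) x with hc
  have hc0 : 0 < c := by linarith
  set T := (totalVariation u).toReal with hTdef
  have hT0 : 0 ≤ T := ENNReal.toReal_nonneg
  -- The competitor below gains `ε * c` and loses at most `ε ^ 2 * (T + 1)`: one `ε ^ 2` from the
  -- near-optimality of `w`, and `ε ^ 2 * T` from shrinking `w`. This choice makes the gain win.
  obtain ⟨ε, hε0, hε1, hεc⟩ : ∃ ε : ℝ, 0 < ε ∧ ε < 1 ∧ ε * (T + 1) < c := by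
    refine ⟨min (1 / 2) (c / (2 * (T + 1))), by positivity, by
      linarith [min_le_left (1 / 2 : ℝ) (c / (2 * (T + 1)))], ?_⟩
    calc _ ≤ c / (2 * (T + 1)) * (T + 1) := by gcongr; exact min_le_right _ _
      _ = c / 2 := by field_simp
      _ < c := by linarith
  obtain ⟨w, hw, hwt, hwi⟩ := exists_radial_lt_integral hu h (sq_pos_of_pos hε0)
  have hε2 : 0 ≤ 1 - ε ^ 2 := by nlinarith
  -- `w` is orthogonal to the tangential field, so squared norms add and the weights `s`, `ε` with
  -- `s ^ 2 + ε ^ 2 = 1` keep the norm at most one.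
  set s := √(1 - ε ^ 2) with hs
  have hs2 : s ^ 2 = 1 - ε ^ 2 := sq_sqrt hε2
  have hs0 : 0 ≤ s := sqrt_nonneg _
  have hs1 : s ≤ 1 := by nlinarith
  have hadm : IsAdmissibleField fun x ↦ s • w x + ε • (b x • quarterTurn x) := by
    refine ⟨(hw.1.const_smul _).add (hb.1.const_smul _),
      (hw.2.smul_left (f := fun _ ↦ s)).add (hb.2.smul_left (f := fun _ ↦ ε)), fun x ↦ ?_⟩
    have h1 := hw.norm_le_one x
    have h2 := hb.norm_le_one x
    rw [← sq_le_one_iff₀ (norm_nonneg _), norm_add_sq_real]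
    simp only [inner_smul_left, inner_smul_right, hwt x, norm_smul s, norm_smul ε, mul_pow,
      norm_eq_abs, sq_abs, hs2]
    have h3 : ‖w x‖ ^ 2 ≤ 1 := by nlinarith [norm_nonneg (w x)]
    have h4 : ‖b x • quarterTurn x‖ ^ 2 ≤ 1 := by nlinarith [norm_nonneg (b x • quarterTurn x)]
    simp only [mul_zero, add_zero]
    nlinarith [sq_nonneg ε]
  have hi := hadm.le_toReal_totalVariation hT
  simp only [divergence_add_smul (hw.1.differentiable (by simp))
    (hb.1.differentiable (by simp)), mul_add, mul_left_comm (u _)] at hi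
  have hiw : Integrable fun x ↦ u x * divergence w x :=
    hu.integrable_mul (memLp_divergence hw.1 hw.2)
  have hib : Integrable fun x ↦ u x * divergence (fun x ↦ b x • quarterTurn x) x :=
    hu.integrable_mul (memLp_divergence hb.1 hb.2)
  rw [integral_add (hiw.const_mul s) (hib.const_mul ε), integral_const_mul,
    integral_const_mul] at hi
  have h1 : s * (T - ε ^ 2) ≤ s * (-∫ x, u x * divergence w x) := by gcongr
  have h2 : 1 - ε ^ 2 ≤ s := by nlinarith
  have h3 : (1 - ε ^ 2) * T ≤ s * T := by gcongr
  have h4 : s * ε ^ 2 ≤ ε ^ 2 := mul_le_of_le_one_left (sq_nonneg _) hs1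
  have h5 : ε * c ≤ ε * (ε * (T + 1)) := by
    rw [hc]; linarith
  exact absurd (le_of_mul_le_mul_left h5 hε0) (not_le.2 hεc)

/-- The sign condition extends by scaling to all test functions `b`; applied to both `b` and `-b`,
it gives equality. -/
lemma integral_tangential_derivative_eq_zero {u : Plane → ℝ} (hu : MemLp u 2 volume)
    (hT : totalVariation u < ⊤) (h : totalVariation (radialisation u) = totalVariation u)
    {b : Plane → ℝ} (hb : ContDiff ℝ ∞ b) (hbc : HasCompactSupport b) :
    ∫ x, u x * fderiv ℝ b x (quarterTurn x) = 0 := by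
  have key {b : Plane → ℝ} (hb : ContDiff ℝ ∞ b) (hbc : HasCompactSupport b) :
      0 ≤ ∫ x, u x * fderiv ℝ b x (quarterTurn x) := by
    have hzc : ContDiff ℝ ∞ (fun x ↦ b x • quarterTurn x) := hb.smul quarterTurn.contDiff
    have hzs : HasCompactSupport (fun x ↦ b x • quarterTurn x) := hbc.smul_right
    obtain ⟨M, hM⟩ := hzs.exists_bound_of_continuous hzc.continuous
    have hM1 : 0 < |M| + 1 := by positivity
    have hadm : IsAdmissibleField fun x ↦ ((|M| + 1)⁻¹ • b x) • quarterTurn x := by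
      simp only [smul_assoc]
      refine ⟨hzc.const_smul _, hzs.smul_left (f := fun _ ↦ (|M| + 1)⁻¹), fun x ↦ ?_⟩
      rw [norm_smul, norm_inv, norm_of_nonneg hM1.le, inv_mul_le_one₀ hM1]
      linarith [hM x, le_abs_self M]
    have h1 := integral_divergence_tangential_nonneg hu hT h
      (b := fun x ↦ (|M| + 1)⁻¹ • b x) hadm
    have hd (x : Plane) : divergence (fun x ↦ ((|M| + 1)⁻¹ • b x) • quarterTurn x) x
        = (|M| + 1)⁻¹ * fderiv ℝ b x (quarterTurn x) := by
      rw [divergence_smul_quarterTurn ((hb.const_smul _).differentiable (by simp)),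
        fderiv_fun_const_smul (hb.differentiable (by simp) x)]
      simp
    simp only [hd, mul_left_comm (u _), integral_const_mul] at h1
    exact nonneg_of_mul_nonneg_right h1 (by positivity)
  refine le_antisymm ?_ (key hb hbc)
  have h1 := key hb.neg hbc.neg
  simpa [fderiv_fun_neg, integral_neg] using h1

/-! ### From vanishing angular derivative to radiality -/

/-- The difference between a function and its radialisation, in terms of the angular
derivative. -/
lemma sub_radialisation_eq_integral {b : Plane → ℝ} (hb : ContDiff ℝ ∞ b) (x : Plane) :
    b x - radialisation b x = ∫ θ, θ * fderiv ℝ b (planeRotation θ x)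
      (quarterTurn (planeRotation θ x)) ∂angleMeasure := by
  have hr := continuous_planeRotation_left x
  have hd (θ : ℝ) : HasDerivAt (fun θ ↦ b (planeRotation θ x))
      (fderiv ℝ b (planeRotation θ x) (quarterTurn (planeRotation θ x))) θ := by
    refine (hb.differentiable (by simp) _).hasFDerivAt.comp_hasDerivAt θ ?_
    rw [← planeRotation_quarterTurn]
    have : HasDerivAt (fun θ ↦ cos θ • x + sin θ • quarterTurn x)
        (-sin θ • x + cos θ • quarterTurn x) θ :=
      ((hasDerivAt_cos θ).smul_const x).add ((hasDerivAt_sin θ).smul_const (quarterTurn x))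
    have h1 : planeRotation θ (quarterTurn x) = -sin θ • x + cos θ • quarterTurn x := by
      ext i; fin_cases i <;> simp; ring
    rw [h1]
    simpa only [planeRotation_eq] using this
  have hc : Continuous fun θ ↦ fderiv ℝ b (planeRotation θ x) (quarterTurn (planeRotation θ x)) :=
    ((hb.continuous_fderiv (by simp)).comp hr).clm_apply (quarterTurn.continuous.comp hr)
  -- Integrating by parts against the weight `θ` leaves the boundary term `2 * π * b x`, since the
  -- full turn returns to `x`, minus the integral of `b` over the angles.
  have hparts := intervalIntegral.integral_mul_deriv_eq_deriv_mul (a := 0) (b := 2 * π)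
    (fun θ _ ↦ hasDerivAt_id θ) (fun θ _ ↦ hd θ) intervalIntegrable_const
    (hc.intervalIntegrable _ _)
  have hper : planeRotation (2 * π) x = x := by
    simpa using planeRotation_periodic x 0
  simp only [id, hper, one_mul, zero_mul, sub_zero] at hparts
  rw [radialisation_eq_of_continuous hb.continuous, integral_angleMeasure, integral_angleMeasure,
    hparts, smul_eq_mul, smul_eq_mul]
  have := pi_pos
  field_simp

lemma fderiv_comp_planeRotation {b : Plane → ℝ} (hb : Differentiable ℝ b) (θ : ℝ) (x : Plane) :
    fderiv ℝ (fun y ↦ b (planeRotation θ y)) x (quarterTurn x)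
      = fderiv ℝ b (planeRotation θ x) (quarterTurn (planeRotation θ x)) := by
  have h : HasFDerivAt (fun y ↦ b (planeRotation θ y)) _ x :=
    (hb _).hasFDerivAt.comp x (planeRotation θ).toContinuousLinearEquiv.hasFDerivAt
  rw [h.fderiv, ← planeRotation_quarterTurn]
  rfl

/-- If radialising does not decrease the total variation then the function is radial. -/
lemma ae_eq_radialisation {u : Plane → ℝ} (hu : MemLp u 2 volume)
    (hT : totalVariation u < ⊤) (h : totalVariation (radialisation u) = totalVariation u) :
    u =ᵐ[volume] radialisation u := by
  have hru := memLp_radialisation hu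
  have hloc : LocallyIntegrable (fun x ↦ u x - radialisation u x) volume :=
    (hu.sub hru).locallyIntegrable (by norm_num)
  refine (ae_eq_zero_of_integral_contDiff_smul_eq_zero hloc fun b hb hbc ↦ ?_).mono
    fun x hx ↦ sub_eq_zero.1 hx
  have hbL : MemLp b 2 volume := hb.continuous.memLp_of_hasCompactSupport hbc
  have hbd : Differentiable ℝ b := hb.differentiable (by simp)
  set G : Plane → ℝ := fun x ↦ fderiv ℝ b x (quarterTurn x) with hG
  have hGc : Continuous G := (hb.continuous_fderiv (by simp)).clm_apply quarterTurn.continuous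
  have hGs : HasCompactSupport G :=
    (hbc.fderiv ℝ).mono fun x hx h0 ↦ hx (by simp [hG, h0])
  have hGL : MemLp G 2 volume := hGc.memLp_of_hasCompactSupport hGs
  have hint : Integrable (fun p : Plane × ℝ ↦ p.2 * (u p.1 * G (planeRotation p.2 p.1)))
      ((volume : Measure Plane).prod angleMeasure) := by
    refine ((hu.comp_fst _).integrable_mul (memLp_planeRotation hGL continuous_id)).bdd_mul
      (c := 2 * π) measurable_snd.aestronglyMeasurable ?_
    filter_upwards [Measure.quasiMeasurePreserving_snd.ae ae_angleMeasure_mem] with p hp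
    rw [norm_of_nonneg hp.1.le]
    exact hp.2
  -- The angular derivative commutes with rotations, so the rotated `G` is the angular derivative of
  -- the rotated test function.
  have hzero (θ : ℝ) : ∫ x, u x * G (planeRotation θ x) = 0 := by
    have h1 := integral_tangential_derivative_eq_zero hu hT h
      (b := fun y ↦ b (planeRotation θ y)) (hb.comp (planeRotation θ).contDiff)
      (hbc.comp_homeomorph (planeRotation θ).toHomeomorph)
    simpa only [fderiv_comp_planeRotation hbd] using h1
  have hub : Integrable fun x ↦ u x * b x := hu.integrable_mul hbL
  have hrub : Integrable fun x ↦ radialisation u x * b x := hru.integrable_mul hbL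
  have hurb : Integrable fun x ↦ u x * radialisation b x :=
    hu.integrable_mul (memLp_radialisation hbL)
  calc ∫ x, b x • (u x - radialisation u x)
      = ∫ x, (u x * b x - radialisation u x * b x) := by
        congr 1 with x; rw [smul_eq_mul]; ring
    _ = (∫ x, u x * b x) - ∫ x, u x * radialisation b x := by
        rw [integral_sub hub hrub, integral_radialisation_mul hu hbL]
    _ = ∫ x, u x * (b x - radialisation b x) := by
        simp only [mul_sub]
        rw [integral_sub hub hurb]
    _ = ∫ x : Plane, ∫ θ, θ * (u x * G (planeRotation θ x)) ∂angleMeasure := by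
        congr 1 with x
        rw [sub_radialisation_eq_integral hb, ← integral_const_mul]
        simp only [hG, mul_left_comm]
    _ = ∫ θ, (∫ x : Plane, θ * (u x * G (planeRotation θ x))) ∂angleMeasure :=
        integral_integral_swap hint
    _ = 0 := by simp [integral_const_mul, hzero]

end

theorem mainTheorem11 (u : Plane → ℝ) (hu : MemLp u 2 volume) (hTV : totalVariation u < ⊤) :
    (∀ᵐ x : Plane, IntegrableOn (fun e : Plane => u (‖x‖ • e)) (sphere (0 : Plane) 1) μH[1]) ∧
      MemLp (radialisation u) 2 volume ∧
      totalVariation (radialisation u) ≤ totalVariation u ∧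
      (totalVariation (radialisation u) = totalVariation u ↔ IsRadial u) :=
  ⟨ae_integrableOn_circle hu, memLp_radialisation hu, totalVariation_radialisation_le hu,
    fun h ↦ isRadial_of_ae_eq_radialisation (ae_eq_radialisation hu hTV h),
    fun h ↦ totalVariation_congr h.radialisation_ae_eq⟩
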